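/- Let $N\ge 3$ and identify $\partial\mathbb H^N$ with $\mathbb R^{N-1}\cup\{\infty\}$ as in the upper half-space model. Let $\mathrm{Homeo}(\partial\mathbb H^N)$ be its group of homeomorphisms with the uniform topology, let $G$ be a cocompact Kleinian group, that is, a discrete group of isometries of $\mathbb H^N$ with compact quotient, acting on $\partial\mathbb H^N$ by boundary maps, and let $f\in\mathrm{Homeo}(\partial\mathbb H^N)$. Suppose that there is a map $\Phi:\mathbb R^{N-1}\setminus\{0\}\to\mathbb R^{N-1}$ such that 1. $f(w)=w+\Phi(w)+o(1)$ as $w\to\infty$ in $\mathbb R^{N-1}$ (in particular $f(w)\neq\infty$ for $\|w\|$ large, and $f(\infty)=\infty$); 2. $\Phi$ is homogeneous of degree $0$: $\Phi(rw)=\Phi(w)$ for all $r>0$ and $w\ne0$; 3. $\Phi$ is not identically zero; 4. $\Phi(w+v)=\Phi(w)+O(\|v\|/\|w\|)$: there are constants $C$ and $\delta>0$ such that $\|\Phi(w+v)-\Phi(w)\|\le C\|v\|/\|w\|$ whenever $w\neq0$ and $\|v\|\le\delta\|w\|$. Then the closure $\overline{\langle G,f\rangle}$ in $\mathrm{Homeo}(\partial\mathbb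 H^N)$ of the group generated by $G$ and $f$ contains a non-trivial continuous one-parameter subgroup $(f_t)_{t\in\mathbb R}$ that is conformally conjugate to a flow of Euclidean translations: there are a conformal (Möbius) homeomorphism $\varphi$ of $\partial\mathbb H^N$ and a vector $b\in\mathbb R^{N-1}$, $b\neq0$, such that $f_t=\varphi^{-1}\circ\tau_{tb}\circ\varphi$ for all $t\in\mathbb R$, where $\tau_{tb}(w)=w+tb$ for $w\in\mathbb R^{N-1}$ and $\tau_{tb}(\infty)=\infty$. -/

import Mathlib

open Filter Topology

noncomputable section

namespace HypBoundary

/-! ## Hyperbolic space of dimension `d + 1` and its isometries (hyperboloid model) -/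

/-- Minkowski space `ℝ^{d+1,1}`: the coordinates are `x ∈ ℝ^d` (`Sum.inl i`), one further space
coordinate (`Sum.inr 0`) and the time coordinate (`Sum.inr 1`). -/
abbrev Minkowski (d : ℕ) : Type := Fin d ⊕ Fin 2 → ℝ

/-- The Lorentz form of signature `(d+1, 1)`. -/
def lorentz {d : ℕ} (v w : Minkowski d) : ℝ :=
  (∑ i : Fin d, v (Sum.inl i) * w (Sum.inl i)) + v (Sum.inr 0) * w (Sum.inr 0)
    - v (Sum.inr 1) * w (Sum.inr 1)

/-- The hyperboloid model of hyperbolic space `ℍ^{d+1}`. -/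
def hyperboloid (d : ℕ) : Set (Minkowski d) :=
  {v | lorentz v v = -1 ∧ 0 < v (Sum.inr 1)}

/-- The group of all isometries of `ℍ^{d+1}`: the linear maps that preserve the Lorentz form and
the upper sheet of the hyperboloid, i.e. `O⁺(d+1, 1)`. It is a group of invertible matrices and
inherits the topology of `GL`. -/
def isometryGroup (d : ℕ) : Subgroup (GL (Fin d ⊕ Fin 2) ℝ) where
  carrier := {A | (∀ v w : Minkowski d,
      lorentz (A.val.mulVec v) (A.val.mulVec w) = lorentz v w) ∧
    ∀ v : Minkowski d, A.val.mulVec v ∈ hyperboloid d ↔ v ∈ hyperboloid d}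
  one_mem' := by simp
  mul_mem' := by
    rintro A B ⟨hA, hA'⟩ ⟨hB, hB'⟩
    refine ⟨fun v w => ?_, fun v => ?_⟩
    · simp only [Units.val_mul, ← Matrix.mulVec_mulVec, hA, hB]
    · simp only [Units.val_mul, ← Matrix.mulVec_mulVec, hA', hB']
  inv_mem' := by
    rintro A ⟨hA, hA'⟩
    have key : ∀ v : Minkowski d, A.val.mulVec ((A⁻¹).val.mulVec v) = v := by
      intro v
      rw [Matrix.mulVec_mulVec, ← Units.val_mul]
      simp
    refine ⟨fun v w => ?_, fun v => ?_⟩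
    · rw [← hA, key, key]
    · rw [← hA', key]

/-! ## The boundary `ℝ^d ∪ {∞}` -/

/-- The boundary `∂ℍ^{d+1} = ℝ^d ∪ {∞}`, as in the upper half-space model. -/
abbrev Boundary (d : ℕ) : Type := OnePoint (EuclideanSpace ℝ (Fin d))

/-- Points of the boundary as future-directed null vectors: `x ∈ ℝ^d` is the ray of
`(x, (|x|² - 1)/2, (|x|² + 1)/2)`, and `∞` is the ray of `(0, 1, 1)`. In these coordinates the
upper half-space point `(x, s)` is the point `(x/s, (|x|²+s²-1)/(2s), (|x|²+s²+1)/(2s))` of the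
hyperboloid, so that this is the boundary identification of the upper half-space model. -/
def nullVector {d : ℕ} : Boundary d → Minkowski d
  | none => Sum.elim (fun _ => 0) ![1, 1]
  | some x => Sum.elim (fun i => x i) ![(‖x‖ ^ 2 - 1) / 2, (‖x‖ ^ 2 + 1) / 2]

/-- `g` is the boundary map of the isometry `A`: it describes the action of `A` on null rays. -/
def IsBoundaryMap {d : ℕ} (A : GL (Fin d ⊕ Fin 2) ℝ) (g : Boundary d ≃ₜ Boundary d) : Prop :=
  ∀ ξ : Boundary d, ∃ c : ℝ, 0 < c ∧ A.val.mulVec (nullVector ξ) = c • nullVector (g ξ)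

/-- The conformal (Möbius) homeomorphisms of the boundary: the boundary maps of the isometries of
hyperbolic space (orientation reversing ones included). -/
def IsConformal {d : ℕ} (g : Boundary d ≃ₜ Boundary d) : Prop :=
  ∃ A ∈ isometryGroup d, IsBoundaryMap A g

/-- A cocompact Kleinian group, regarded as a group of homeomorphisms of the boundary: `G`
consists of the boundary maps of the elements of a discrete group `Γ` of isometries of `ℍ^{d+1}`
such that the `Γ`-translates of some compact set cover `ℍ^{d+1}`. -/
def IsCocompactKleinian {d : ℕ} (G : Subgroup (Boundary d ≃ₜ Boundary d)) : Prop :=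
  ∃ Γ : Subgroup (GL (Fin d ⊕ Fin 2) ℝ),
    Γ ≤ isometryGroup d ∧
    DiscreteTopology Γ ∧
    (∃ K : Set (Minkowski d), IsCompact K ∧ K ⊆ hyperboloid d ∧
      ∀ v ∈ hyperboloid d, ∃ A ∈ Γ, ∃ k ∈ K, A.val.mulVec k = v) ∧
    (∀ A ∈ Γ, ∃ g ∈ G, IsBoundaryMap A g) ∧
    (∀ g ∈ G, ∃ A ∈ Γ, IsBoundaryMap A g)

/-! ## The topological group of homeomorphisms of the boundary -/

/-- The uniform topology on the homeomorphisms of the boundary. The boundary is compact, so the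
topology of uniform convergence is the compact-open topology. -/
instance homeoTopology (d : ℕ) : TopologicalSpace (Boundary d ≃ₜ Boundary d) :=
  TopologicalSpace.induced (fun g => (⟨g, g.continuous⟩ : C(Boundary d, Boundary d)))
    ContinuousMap.compactOpen

/-- The closed group generated by `G` and `f`, as a set: the closure of the group `⟨G, f⟩`. -/
def closedGroupGenerated {d : ℕ} (G : Subgroup (Boundary d ≃ₜ Boundary d))
    (f : Boundary d ≃ₜ Boundary d) : Set (Boundary d ≃ₜ Boundary d) :=
  closure (G ⊔ Subgroup.zpowers f : Subgroup (Boundary d ≃ₜ Boundary d))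

/-- A non-trivial (continuous) one-parameter subgroup of the homeomorphism group. -/
structure IsNontrivialOneParameterSubgroup {d : ℕ} (F : ℝ → (Boundary d ≃ₜ Boundary d)) :
    Prop where
  map_add : ∀ s t : ℝ, F (s + t) = F s * F t
  continuous : Continuous F
  nontrivial : ∃ t : ℝ, F t ≠ 1

/-- The Euclidean translation `x ↦ x + b` of `ℝ^d`, extended to the boundary by `∞ ↦ ∞`. -/
def translation {d : ℕ} (b : EuclideanSpace ℝ (Fin d)) : Boundary d ≃ₜ Boundary d :=
  (Homeomorph.addRight b).onePointCongr

/-- `F` is conformally conjugate to a flow of Euclidean translations `x ↦ x + t b`. -/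
def IsConformallyConjugateToTranslations {d : ℕ} (F : ℝ → (Boundary d ≃ₜ Boundary d)) : Prop :=
  ∃ φ : Boundary d ≃ₜ Boundary d, IsConformal φ ∧
    ∃ b : EuclideanSpace ℝ (Fin d), ∀ t : ℝ, F t = φ⁻¹ * translation (t • b) * φ

/-! ## The hypotheses on `f` near infinity -/

/-- `Φ` is (positively) homogeneous of degree zero on `ℝ^d ∖ {0}`; the value at `0` is
irrelevant. -/
def HomogeneousDegreeZero {d : ℕ}
    (Φ : EuclideanSpace ℝ (Fin d) → EuclideanSpace ℝ (Fin d)) : Prop :=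
  ∀ r : ℝ, 0 < r → ∀ w, w ≠ 0 → Φ (r • w) = Φ w

/-- `Φ(w + v) = Φ(w) + O(|v| / |w|)`, for `w ≠ 0` and `|v| / |w|` small. -/
def HasAngularLipschitzBound {d : ℕ}
    (Φ : EuclideanSpace ℝ (Fin d) → EuclideanSpace ℝ (Fin d)) : Prop :=
  ∃ C : ℝ, ∃ δ : ℝ, 0 < δ ∧ ∀ w v, w ≠ 0 → ‖v‖ ≤ δ * ‖w‖ →
    ‖Φ (w + v) - Φ w‖ ≤ C * (‖v‖ / ‖w‖)

/-- `f(w) = w + Φ(w) + o(1)` in a neighbourhood of `w = ∞`: for `|w|` large the point `f(w)` is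
a finite point `f₀(w)`, and `f₀(w) - (w + Φ(w)) → 0` as `w → ∞`. -/
def HasExpansionAtInfinity {d : ℕ} (f : Boundary d ≃ₜ Boundary d)
    (Φ : EuclideanSpace ℝ (Fin d) → EuclideanSpace ℝ (Fin d)) : Prop :=
  ∃ f₀ : EuclideanSpace ℝ (Fin d) → EuclideanSpace ℝ (Fin d),
    (∀ᶠ w : EuclideanSpace ℝ (Fin d) in Bornology.cobounded (EuclideanSpace ℝ (Fin d)),
      f (w : Boundary d) = (f₀ w : Boundary d)) ∧
    Tendsto (fun w => f₀ w - (w + Φ w)) (Bornology.cobounded (EuclideanSpace ℝ (Fin d))) (𝓝 0)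

end HypBoundary

end

noncomputable section

namespace HypBoundary

/-! ## Null vectors and the embedding of the boundary into Minkowski space -/

variable {d : ℕ}

/-! Fix `w₀ ≠ 0` with `Φ w₀ ≠ 0`. On a ball of radius `O(s)` around `s² w₀` the angular bound lets
`Φ` vary only by `O(1/s)`, so there `f` is translation by `Φ w₀` up to `o(1)`. The displacement of
`f` is bounded, so `⌊ts⌋` iterates stay in such a ball and move points by `ts Φ w₀ + o(s)`. With `β
w = s w + s² w₀`, the conjugates `β⁻¹ f^⌊ts⌋ β` therefore converge to translation by `t Φ w₀`
(`tendsto_rescaledIterate`).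

The similarities `β` need not lie in `G`. Cocompactness supplies `A` in the discrete group with `A⁻¹
β` in a compact set of isometries, hence converging to some `H` along an ultrafilter
(`IsCocompactKleinian.exists_tendsto`). Since `A⁻¹ f^m A = (A⁻¹β)(β⁻¹ f^m β)(A⁻¹β)⁻¹`, elements of
`⟨G, f⟩` converge to `H τ H⁻¹` with `τ` the translation by `t Φ w₀`. The limit `H` does not depend
on `t`, so these limits form one conjugated flow. -/

theorem nullVector_infty : nullVector (OnePoint.infty : Boundary d) =
    Sum.elim (fun _ => 0) ![1, 1] := rfl

theorem nullVector_coe (x : EuclideanSpace ℝ (Fin d)) : nullVector (x : Boundary d) =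
    Sum.elim (fun i => x i) ![(‖x‖ ^ 2 - 1) / 2, (‖x‖ ^ 2 + 1) / 2] := rfl

theorem nullVector_time_pos (ξ : Boundary d) : 0 < nullVector ξ (Sum.inr 1) := by
  induction ξ using OnePoint.rec with
  | infty => simp [nullVector_infty]
  | coe x => simp only [nullVector_coe, Sum.elim_inr, Matrix.cons_val_one, Matrix.cons_val_fin_one]
             positivity

theorem lorentz_nullVector (ξ : Boundary d) : lorentz (nullVector ξ) (nullVector ξ) = 0 := by
  induction ξ using OnePoint.rec with
  | infty => simp [nullVector_infty, lorentz]
  | coe x =>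
    have h := EuclideanSpace.real_norm_sq_eq x
    simp only [nullVector_coe, lorentz, Sum.elim_inl, Sum.elim_inr, Matrix.cons_val_one,
      Matrix.cons_val_zero, Matrix.cons_val_fin_one, ← pow_two]
    rw [← h]
    ring

theorem exists_eq_smul_nullVector {v : Minkowski d} (hv : lorentz v v = 0)
    (hpos : 0 < v (Sum.inr 1)) : ∃ ξ : Boundary d, ∃ c : ℝ, 0 < c ∧ v = c • nullVector ξ := by
  set a := v (Sum.inr 0) with ha
  set t := v (Sum.inr 1) with ht
  have hs : ∑ i : Fin d, v (Sum.inl i) ^ 2 = t ^ 2 - a ^ 2 := by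
    have : lorentz v v = ∑ i : Fin d, v (Sum.inl i) ^ 2 + a * a - t * t := by
      simp [lorentz, pow_two, ha, ht]
    rw [hv] at this
    linarith
  have hnn : 0 ≤ ∑ i : Fin d, v (Sum.inl i) ^ 2 := Finset.sum_nonneg fun i _ => sq_nonneg _
  have hat : a ≤ t := abs_le_of_sq_le_sq' (by linarith) hpos.le |>.2
  rcases hat.eq_or_lt with h | h
  · refine ⟨OnePoint.infty, t, hpos, ?_⟩
    have hz : ∀ i, v (Sum.inl i) = 0 := by
      rw [h, sub_self, Finset.sum_eq_zero_iff_of_nonneg fun i _ => sq_nonneg _] at hs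
      intro i
      simpa using hs i (Finset.mem_univ i)
    ext j
    rcases j with i | j
    · simp [nullVector_infty, hz]
    · fin_cases j
      · simpa [nullVector_infty] using h
      · simp [nullVector_infty, ht]
  -- The null vector of a finite point has time minus last space coordinate equal to `1`, which
  -- forces the factor `t - a`; the case `t = a` is the ray of `∞`.
  · have hc : 0 < t - a := sub_pos.2 h
    let y : EuclideanSpace ℝ (Fin d) := WithLp.toLp 2 fun i => (t - a)⁻¹ * v (Sum.inl i)
    have hy : ‖y‖ ^ 2 = (t + a) / (t - a) := by
      rw [EuclideanSpace.real_norm_sq_eq]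
      simp only [y, mul_pow, ← Finset.mul_sum, hs]
      field_simp
      ring
    refine ⟨(y : Boundary d), t - a, hc, ?_⟩
    ext j
    rcases j with i | j
    · simp [nullVector_coe, y, hc.ne']
    · fin_cases j
      · simp only [Fin.zero_eta, nullVector_coe, hy, Pi.smul_apply, Sum.elim_inr,
          Matrix.cons_val_zero, smul_eq_mul, ← ha]
        field_simp
        ring
      · simp only [Fin.mk_one, nullVector_coe, hy, Pi.smul_apply, Sum.elim_inr,
          Matrix.cons_val_one, Matrix.cons_val_fin_one, smul_eq_mul, ← ht]
        field_simp
        ring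

/-- Rescaling of a vector to time coordinate one. -/
def timeNormalize (v : Minkowski d) : Minkowski d := (v (Sum.inr 1))⁻¹ • v

theorem timeNormalize_smul {c : ℝ} (hc : c ≠ 0) (v : Minkowski d) :
    timeNormalize (c • v) = timeNormalize v := by
  simp only [timeNormalize, Pi.smul_apply, smul_eq_mul, mul_inv, smul_smul]
  congr 1
  field_simp

/-- The time-one slice of the light cone is a round sphere, and the normalized null vector is
inverse stereographic projection. -/
theorem injective_timeNormalize_nullVector :
    Function.Injective fun ξ : Boundary d => timeNormalize (nullVector ξ) := by
  intro ξ η h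
  simp only [timeNormalize] at h
  induction ξ using OnePoint.rec with
  | infty =>
    induction η using OnePoint.rec with
    | infty => rfl
    | coe y =>
      have h0 := congrFun h (Sum.inr 0)
      simp [nullVector_infty, nullVector_coe] at h0
      have : 0 < ‖y‖ ^ 2 + 1 := by positivity
      field_simp at h0
      linarith
  | coe x =>
    induction η using OnePoint.rec with
    | infty =>
      have h0 := congrFun h (Sum.inr 0)
      simp [nullVector_infty, nullVector_coe] at h0
      have : 0 < ‖x‖ ^ 2 + 1 := by positivity
      field_simp at h0
      linarith
    | coe y =>
      have h0 := congrFun h (Sum.inr 0)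
      have hx : 0 < ‖x‖ ^ 2 + 1 := by positivity
      have hy : 0 < ‖y‖ ^ 2 + 1 := by positivity
      simp [nullVector_coe] at h0
      have hxy : ‖x‖ ^ 2 = ‖y‖ ^ 2 := by
        field_simp at h0
        linarith
      congr 1
      ext i
      have h1 := congrFun h (Sum.inl i)
      simp only [nullVector_coe, Pi.smul_apply, Sum.elim_inr, Matrix.cons_val_one,
        Matrix.cons_val_fin_one, Sum.elim_inl, smul_eq_mul, hxy] at h1
      exact mul_left_cancel₀ (by positivity) h1

theorem continuous_timeNormalize_nullVector :
    Continuous fun ξ : Boundary d => timeNormalize (nullVector ξ) := by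
  rw [OnePoint.continuous_iff]
  constructor
  · rw [Filter.coclosedCompact_eq_cocompact, ← Metric.cobounded_eq_cocompact]
    have hn : Tendsto (fun x : EuclideanSpace ℝ (Fin d) => ‖x‖) (Bornology.cobounded _) atTop :=
      tendsto_norm_cobounded_atTop
    -- A common majorant for the errors `2|x i|/(‖x‖²+1)` and `2/(‖x‖²+1)` of the space coordinates.
    have hlim : Tendsto (fun x : EuclideanSpace ℝ (Fin d) => 4 / (‖x‖ + 1))
        (Bornology.cobounded _) (𝓝 0) :=
      Tendsto.div_atTop tendsto_const_nhds (tendsto_atTop_add_const_right _ _ hn)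
    rw [tendsto_pi_nhds]
    rintro (i | j)
    · have : timeNormalize (nullVector (OnePoint.infty : Boundary d)) (Sum.inl i) = 0 := by
        simp [timeNormalize, nullVector_infty]
      rw [this]
      refine squeeze_zero_norm (fun x => ?_) hlim
      simp only [timeNormalize, nullVector_coe, Pi.smul_apply, Sum.elim_inr, Matrix.cons_val_one,
        Matrix.cons_val_fin_one, Sum.elim_inl, smul_eq_mul, norm_mul]
      have hx : ‖x i‖ ≤ ‖x‖ := PiLp.norm_apply_le x i
      have h0 : 0 < ‖x‖ ^ 2 + 1 := by positivity
      rw [norm_inv, Real.norm_of_nonneg (by positivity : 0 ≤ (‖x‖ ^ 2 + 1) / 2), inv_mul_eq_div,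
        div_le_div_iff₀ (by positivity) (by positivity)]
      nlinarith [norm_nonneg x, norm_nonneg (x i), sq_nonneg (‖x‖ - 1)]
    · fin_cases j
      · have : timeNormalize (nullVector (OnePoint.infty : Boundary d)) (Sum.inr 0) = 1 := by
          simp [timeNormalize, nullVector_infty]
        simp only [Fin.zero_eta]
        rw [this, tendsto_iff_norm_sub_tendsto_zero]
        refine squeeze_zero (fun x => norm_nonneg _) (fun x => ?_) hlim
        have h0 : 0 < ‖x‖ ^ 2 + 1 := by positivity
        have he : timeNormalize (nullVector (x : Boundary d)) (Sum.inr 0) - 1 =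
            -(2 / (‖x‖ ^ 2 + 1)) := by
          simp only [timeNormalize, nullVector_coe, Pi.smul_apply, Sum.elim_inr,
            Matrix.cons_val_one, Matrix.cons_val_fin_one, Matrix.cons_val_zero, smul_eq_mul]
          field_simp
          ring
        rw [he, norm_neg, Real.norm_of_nonneg (by positivity),
          div_le_div_iff₀ (by positivity) (by positivity)]
        nlinarith [norm_nonneg x, sq_nonneg (‖x‖ - 1)]
      · have : ∀ ξ : Boundary d, timeNormalize (nullVector ξ) (Sum.inr 1) = 1 := fun ξ => by
          simp [timeNormalize, (nullVector_time_pos ξ).ne']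
        simp only [Fin.mk_one, this]
        exact tendsto_const_nhds
  · have hne : ∀ x : EuclideanSpace ℝ (Fin d), (‖x‖ ^ 2 + 1) / 2 ≠ 0 := fun x => by positivity
    rw [continuous_pi_iff]
    rintro (i | j)
    · simp only [timeNormalize, nullVector_coe, Pi.smul_apply, Sum.elim_inr, Matrix.cons_val_one,
        Matrix.cons_val_fin_one, Sum.elim_inl, smul_eq_mul]
      fun_prop (disch := exact hne)
    · fin_cases j <;>
      · simp only [Fin.zero_eta, Fin.mk_one, timeNormalize, nullVector_coe, Pi.smul_apply,
          Sum.elim_inr, Matrix.cons_val_one, Matrix.cons_val_zero, Matrix.cons_val_fin_one,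
          smul_eq_mul]
        fun_prop (disch := exact hne)

/-- A continuous injection of a compact space into a Hausdorff one is a closed embedding. Continuity
of maps into the boundary can thus be tested in Minkowski space. -/
theorem isInducing_timeNormalize_nullVector :
    IsInducing fun ξ : Boundary d => timeNormalize (nullVector ξ) :=
  (continuous_timeNormalize_nullVector.isClosedEmbedding
    injective_timeNormalize_nullVector).isInducing

theorem eq_of_smul_nullVector_eq {c c' : ℝ} (hc : c ≠ 0) (hc' : c' ≠ 0) {ξ η : Boundary d}
    (h : c • nullVector ξ = c' • nullVector η) : ξ = η :=
  injective_timeNormalize_nullVector <| by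
    simpa only [timeNormalize_smul hc, timeNormalize_smul hc'] using congrArg timeNormalize h

/-- The base point of the hyperboloid. -/
def basePoint (d : ℕ) : Minkowski d := Sum.elim 0 ![0, 1]

theorem basePoint_mem : basePoint d ∈ hyperboloid d := by
  simp [basePoint, hyperboloid, lorentz]

theorem lorentz_basePoint (v : Minkowski d) : lorentz v (basePoint d) = -v (Sum.inr 1) := by
  simp [basePoint, lorentz]

theorem basePoint_lorentz (v : Minkowski d) : lorentz (basePoint d) v = -v (Sum.inr 1) := by
  simp [basePoint, lorentz]

theorem time_pos_of_lorentz_neg {u q : Minkowski d} (hu : lorentz u u = 0)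
    (hq : q ∈ hyperboloid d) (h : lorentz u q < 0) : 0 < u (Sum.inr 1) := by
  obtain ⟨hq1, hq0⟩ := hq
  -- Cauchy–Schwarz for the `d + 1` space coordinates, indexed by `Option (Fin d)`. If the time
  -- coordinate of `u` were nonpositive, it would give `lorentz u q ≥ 0`.
  have cs := Finset.sum_mul_sq_le_sq_mul_sq Finset.univ
    (fun o : Option (Fin d) => o.elim (u (Sum.inr 0)) fun i => u (Sum.inl i))
    (fun o : Option (Fin d) => o.elim (q (Sum.inr 0)) fun i => q (Sum.inl i))
  simp only [Fintype.sum_option, Option.elim_none, Option.elim_some] at cs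
  simp only [lorentz, ← pow_two] at hu hq1 h
  by_contra! hle
  set S := ∑ i : Fin d, u (Sum.inl i) * q (Sum.inl i)
  set U := ∑ i : Fin d, u (Sum.inl i) ^ 2
  set Q := ∑ i : Fin d, q (Sum.inl i) ^ 2
  have e1 : u (Sum.inr 0) ^ 2 + U = u (Sum.inr 1) ^ 2 := by linarith
  have e2 : q (Sum.inr 0) ^ 2 + Q = q (Sum.inr 1) ^ 2 - 1 := by linarith
  rw [e1, e2] at cs
  have h2 : (u (Sum.inr 0) * q (Sum.inr 0) + S) ^ 2 ≤ (-u (Sum.inr 1) * q (Sum.inr 1)) ^ 2 := by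
    nlinarith [sq_nonneg (u (Sum.inr 1))]
  have h3 := (abs_le_of_sq_le_sq' h2 (mul_nonneg (by linarith) hq0.le)).1
  linarith

/-! ## The action of isometries on the boundary -/

theorem lorentz_mulVec {A : GL (Fin d ⊕ Fin 2) ℝ} (hA : A ∈ isometryGroup d) (v w : Minkowski d) :
    lorentz (A.val.mulVec v) (A.val.mulVec w) = lorentz v w := hA.1 v w

theorem mulVec_mem_hyperboloid {A : GL (Fin d ⊕ Fin 2) ℝ} (hA : A ∈ isometryGroup d)
    {v : Minkowski d} (hv : v ∈ hyperboloid d) : A.val.mulVec v ∈ hyperboloid d := (hA.2 v).2 hv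

theorem time_mulVec_nullVector_pos {A : GL (Fin d ⊕ Fin 2) ℝ} (hA : A ∈ isometryGroup d)
    (ξ : Boundary d) : 0 < A.val.mulVec (nullVector ξ) (Sum.inr 1) := by
  refine time_pos_of_lorentz_neg (q := A.val.mulVec (basePoint d)) ?_
    (mulVec_mem_hyperboloid hA basePoint_mem) ?_
  · rw [lorentz_mulVec hA, lorentz_nullVector]
  · rw [lorentz_mulVec hA, lorentz_basePoint]
    linarith [nullVector_time_pos ξ]

theorem exists_mulVec_nullVector {A : GL (Fin d ⊕ Fin 2) ℝ} (hA : A ∈ isometryGroup d)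
    (ξ : Boundary d) :
    ∃ η : Boundary d, ∃ c : ℝ, 0 < c ∧ A.val.mulVec (nullVector ξ) = c • nullVector η :=
  exists_eq_smul_nullVector (by rw [lorentz_mulVec hA, lorentz_nullVector])
    (time_mulVec_nullVector_pos hA ξ)

/-- The action of an isometry on the boundary. -/
def boundaryFun (A : isometryGroup d) (ξ : Boundary d) : Boundary d :=
  (exists_mulVec_nullVector A.2 ξ).choose

theorem boundaryFun_spec (A : isometryGroup d) (ξ : Boundary d) : ∃ c : ℝ, 0 < c ∧
    A.1.val.mulVec (nullVector ξ) = c • nullVector (boundaryFun A ξ) :=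
  (exists_mulVec_nullVector A.2 ξ).choose_spec

theorem boundaryFun_eq (A : isometryGroup d) {ξ η : Boundary d} {c : ℝ} (hc : 0 < c)
    (h : A.1.val.mulVec (nullVector ξ) = c • nullVector η) : boundaryFun A ξ = η := by
  obtain ⟨c', hc', h'⟩ := boundaryFun_spec A ξ
  exact eq_of_smul_nullVector_eq hc'.ne' hc.ne' (h'.symm.trans h)

theorem boundaryFun_mul (A B : isometryGroup d) (ξ : Boundary d) :
    boundaryFun (A * B) ξ = boundaryFun A (boundaryFun B ξ) := by
  obtain ⟨b, hb, h⟩ := boundaryFun_spec B ξ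
  obtain ⟨a, ha, h'⟩ := boundaryFun_spec A (boundaryFun B ξ)
  refine boundaryFun_eq _ (mul_pos hb ha) ?_
  rw [Subgroup.coe_mul, Units.val_mul, ← Matrix.mulVec_mulVec, h, Matrix.mulVec_smul, h', smul_smul]

theorem boundaryFun_one (ξ : Boundary d) : boundaryFun (1 : isometryGroup d) ξ = ξ :=
  boundaryFun_eq _ one_pos (by simp)

/-- After time normalization the action is an explicit formula: apply the matrix, then divide by a
time coordinate that never vanishes. Joint continuity is what makes `boundaryHom` continuous into
the compact-open topology. -/
theorem continuous_boundaryFun :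
    Continuous fun p : isometryGroup d × Boundary d => boundaryFun p.1 p.2 := by
  rw [isInducing_timeNormalize_nullVector.continuous_iff]
  have he : (fun ξ : Boundary d => timeNormalize (nullVector ξ)) ∘
      (fun p : isometryGroup d × Boundary d => boundaryFun p.1 p.2) =
      fun p => timeNormalize (p.1.1.val.mulVec (timeNormalize (nullVector p.2))) := by
    ext1 p
    obtain ⟨c, hc, h⟩ := boundaryFun_spec p.1 p.2
    have ht := nullVector_time_pos p.2
    simp only [Function.comp]
    conv_rhs => rw [timeNormalize, timeNormalize, Matrix.mulVec_smul, h]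
    rw [← timeNormalize, timeNormalize_smul (inv_pos.2 ht).ne', timeNormalize_smul hc.ne']
  rw [he]
  have hA : Continuous fun p : isometryGroup d × Boundary d =>
      p.1.1.val.mulVec (timeNormalize (nullVector p.2)) :=
    Continuous.matrix_mulVec
      (Units.continuous_val.comp (continuous_subtype_val.comp continuous_fst))
      (continuous_timeNormalize_nullVector.comp continuous_snd)
  refine Continuous.smul (Continuous.inv₀ ((continuous_apply _).comp hA) fun p => ?_) hA
  simp only [Function.comp, timeNormalize, Matrix.mulVec_smul, Pi.smul_apply, smul_eq_mul]
  exact (mul_pos (inv_pos.2 (nullVector_time_pos _)) (time_mulVec_nullVector_pos p.1.2 _)).ne'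

/-- The boundary map of an isometry. -/
def boundaryHomeo (A : isometryGroup d) : Boundary d ≃ₜ Boundary d where
  toFun := boundaryFun A
  invFun := boundaryFun A⁻¹
  left_inv ξ := by rw [← boundaryFun_mul, inv_mul_cancel, boundaryFun_one]
  right_inv ξ := by rw [← boundaryFun_mul, mul_inv_cancel, boundaryFun_one]
  continuous_toFun := continuous_boundaryFun.comp (.prodMk_right A)
  continuous_invFun := continuous_boundaryFun.comp (.prodMk_right A⁻¹)

/-- Passing to boundary maps is a homomorphism. -/
def boundaryHom (d : ℕ) : isometryGroup d →* (Boundary d ≃ₜ Boundary d) where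
  toFun := boundaryHomeo
  map_one' := Homeomorph.ext boundaryFun_one
  map_mul' A B := Homeomorph.ext (boundaryFun_mul A B)

theorem isBoundaryMap_boundaryHom (A : isometryGroup d) : IsBoundaryMap A.1 (boundaryHom d A) :=
  boundaryFun_spec A

theorem IsBoundaryMap.eq_boundaryHom {A : isometryGroup d} {g : Boundary d ≃ₜ Boundary d}
    (h : IsBoundaryMap A.1 g) : g = boundaryHom d A :=
  Homeomorph.ext fun ξ => by
    obtain ⟨c, hc, hξ⟩ := h ξ
    exact (boundaryFun_eq A hc hξ).symm

theorem continuous_boundaryHom : Continuous (boundaryHom d) :=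
  continuous_induced_rng.2 <|
    ContinuousMap.continuous_of_continuous_uncurry _ continuous_boundaryFun

/-! ## Compactness of isometries with bounded displacement of the base point -/

theorem sq_apply_le_lorentz (v : Minkowski d) (k : Fin d ⊕ Fin 2) :
    v k ^ 2 ≤ max 0 (lorentz v v) + v (Sum.inr 1) ^ 2 := by
  have hnn : 0 ≤ ∑ i : Fin d, v (Sum.inl i) ^ 2 := Finset.sum_nonneg fun i _ => sq_nonneg _
  have hl : lorentz v v = ∑ i : Fin d, v (Sum.inl i) ^ 2 + v (Sum.inr 0) ^ 2
      - v (Sum.inr 1) ^ 2 := by simp only [lorentz, pow_two]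
  rcases k with i | j
  · have := Finset.single_le_sum (f := fun i => v (Sum.inl i) ^ 2) (fun i _ => sq_nonneg _)
      (Finset.mem_univ i)
    nlinarith [le_max_right 0 (lorentz v v), sq_nonneg (v (Sum.inr 0))]
  · fin_cases j
    · simp only [Fin.zero_eta]
      linarith [le_max_right 0 (lorentz v v)]
    · simp

theorem mulVec_inv_mulVec (A : GL (Fin d ⊕ Fin 2) ℝ) (v : Minkowski d) :
    A.val.mulVec ((A⁻¹).val.mulVec v) = v := by
  rw [Matrix.mulVec_mulVec, ← Units.val_mul]
  simp

theorem inv_mulVec_mulVec (A : GL (Fin d ⊕ Fin 2) ℝ) (v : Minkowski d) :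
    (A⁻¹).val.mulVec (A.val.mulVec v) = v := by
  rw [Matrix.mulVec_mulVec, ← Units.val_mul]
  simp

/-- The time coordinate is `cosh` of the distance to the base point, and `A`, `A⁻¹` displace that
point equally. -/
theorem time_inv_mulVec_basePoint {A : GL (Fin d ⊕ Fin 2) ℝ} (hA : A ∈ isometryGroup d) :
    (A⁻¹).val.mulVec (basePoint d) (Sum.inr 1) = A.val.mulVec (basePoint d) (Sum.inr 1) := by
  have h := lorentz_mulVec hA ((A⁻¹).val.mulVec (basePoint d)) (basePoint d)
  rw [mulVec_inv_mulVec, lorentz_basePoint, basePoint_lorentz] at h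
  linarith

theorem lorentz_single_self_le (j : Fin d ⊕ Fin 2) :
    lorentz (Pi.single j 1 : Minkowski d) (Pi.single j 1) ≤ 1 := by
  rcases j with j | j
  · simp [lorentz, Pi.single_apply]
  · fin_cases j <;> simp [lorentz]

theorem sq_lorentz_single (j : Fin d ⊕ Fin 2) (q : Minkowski d) :
    lorentz (Pi.single j 1 : Minkowski d) q ^ 2 = q j ^ 2 := by
  rcases j with j | j
  · simp [lorentz, Pi.single_apply]
  · fin_cases j <;> simp [lorentz]

/-- By invariance of the form, the time entry of column `j` is, up to sign, coordinate `j` of `A⁻¹`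
applied to the base point, hence at most `T`. The column has Lorentz square at most `1`, so its
entries have square at most `1 + T² ≤ (T + 1)²`. -/
theorem abs_entry_le {A : GL (Fin d ⊕ Fin 2) ℝ} (hA : A ∈ isometryGroup d) {T : ℝ}
    (hT : A.val.mulVec (basePoint d) (Sum.inr 1) ≤ T) (i j : Fin d ⊕ Fin 2) :
    |A.val i j| ≤ T + 1 := by
  set q := (A⁻¹).val.mulVec (basePoint d)
  have hq : q ∈ hyperboloid d := mulVec_mem_hyperboloid (inv_mem hA) basePoint_mem
  have hqT : q (Sum.inr 1) ≤ T := (time_inv_mulVec_basePoint hA).trans_le hT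
  set c := A.val.mulVec (Pi.single j 1)
  have hc : A.val i j = c i := by simp [c]
  have hc1 : c (Sum.inr 1) ^ 2 = q j ^ 2 := by
    have h := lorentz_mulVec hA (Pi.single j 1) q
    rw [mulVec_inv_mulVec, lorentz_basePoint] at h
    rw [← sq_lorentz_single j q, ← h, neg_sq]
  have hqj := sq_apply_le_lorentz q j
  rw [hq.1, max_eq_left (by norm_num), zero_add] at hqj
  have hci := sq_apply_le_lorentz c i
  have hcc : max 0 (lorentz c c) ≤ 1 :=
    max_le zero_le_one ((lorentz_mulVec hA _ _).trans_le (lorentz_single_self_le j))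
  have hq0 := hq.2
  rw [hc]
  refine abs_le_of_sq_le_sq (hci.trans ?_) (by linarith)
  nlinarith

theorem one_le_time {v : Minkowski d} (hv : v ∈ hyperboloid d) : 1 ≤ v (Sum.inr 1) := by
  have hnn : 0 ≤ ∑ i : Fin d, v (Sum.inl i) ^ 2 := Finset.sum_nonneg fun i _ => sq_nonneg _
  obtain ⟨h1, h0⟩ := hv
  simp only [lorentz, ← pow_two] at h1
  nlinarith [sq_nonneg (v (Sum.inr 0))]

theorem continuous_lorentz : Continuous fun p : Minkowski d × Minkowski d => lorentz p.1 p.2 := by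
  unfold lorentz
  fun_prop

theorem isClosed_hyperboloid : IsClosed (hyperboloid d) := by
  have : hyperboloid d = {v | lorentz v v = -1} ∩ {v | 1 ≤ v (Sum.inr 1)} := by
    ext v
    exact ⟨fun h => ⟨h.1, one_le_time h⟩, fun h => ⟨h.1, zero_lt_one.trans_le h.2⟩⟩
  rw [this]
  exact (isClosed_eq (continuous_lorentz.comp (continuous_id.prodMk continuous_id))
    continuous_const).inter (isClosed_le continuous_const (continuous_apply _))

/-- Using `A⁻¹` turns the equivalence in the definition into conditions that are visibly closed in
`A`. -/
theorem mem_isometryGroup_iff {A : GL (Fin d ⊕ Fin 2) ℝ} : A ∈ isometryGroup d ↔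
    (∀ v w : Minkowski d, lorentz (A.val.mulVec v) (A.val.mulVec w) = lorentz v w) ∧
      ∀ v ∈ hyperboloid d, A.val.mulVec v ∈ hyperboloid d ∧
        (A⁻¹).val.mulVec v ∈ hyperboloid d := by
  refine ⟨fun hA => ⟨hA.1, fun v hv => ⟨mulVec_mem_hyperboloid hA hv,
    mulVec_mem_hyperboloid (inv_mem hA) hv⟩⟩, fun h => ⟨h.1, fun v => ⟨fun hv => ?_,
    fun hv => (h.2 v hv).1⟩⟩⟩
  simpa only [inv_mulVec_mulVec] using (h.2 _ hv).2

theorem isClosed_isometryGroup : IsClosed (isometryGroup d : Set (GL (Fin d ⊕ Fin 2) ℝ)) := by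
  have h1 (v : Minkowski d) : Continuous fun A : GL (Fin d ⊕ Fin 2) ℝ => A.val.mulVec v :=
    Units.continuous_val.matrix_mulVec continuous_const
  have h2 (v : Minkowski d) : Continuous fun A : GL (Fin d ⊕ Fin 2) ℝ => (A⁻¹).val.mulVec v :=
    (Units.continuous_val.comp continuous_inv).matrix_mulVec continuous_const
  have : (isometryGroup d : Set (GL (Fin d ⊕ Fin 2) ℝ)) =
      {A | (∀ v w : Minkowski d, lorentz (A.val.mulVec v) (A.val.mulVec w) = lorentz v w) ∧
      ∀ v ∈ hyperboloid d, A.val.mulVec v ∈ hyperboloid d ∧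
        (A⁻¹).val.mulVec v ∈ hyperboloid d} := Set.ext fun _ => mem_isometryGroup_iff
  rw [this]
  simp only [Set.ofPred_and, Set.ofPred_forall]
  refine IsClosed.inter (isClosed_iInter fun v => isClosed_iInter fun w => ?_)
    (isClosed_iInter fun v => isClosed_iInter fun _ => ?_)
  · exact isClosed_eq (continuous_lorentz.comp ((h1 v).prodMk (h1 w))) continuous_const
  · exact (isClosed_hyperboloid.preimage (h1 v)).inter (isClosed_hyperboloid.preimage (h2 v))

theorem exists_tendsto_matrix {α m : Type*} (u : Ultrafilter α) {M : α → Matrix m m ℝ} {T : ℝ}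
    (hM : ∀ a i j, |M a i j| ≤ T) : ∃ P, Tendsto M u (𝓝 P) := by
  have hK : IsCompact (Set.pi Set.univ fun _ : m => Set.pi Set.univ fun _ : m => Set.Icc (-T) T) :=
    isCompact_univ_pi fun _ => isCompact_univ_pi fun _ => isCompact_Icc
  obtain ⟨P, -, hP⟩ := hK.ultrafilter_le_nhds (u.map M) <| by
    rw [Filter.le_principal_iff]
    exact Filter.Eventually.of_forall (f := (u : Filter α)) fun a i _ j _ => abs_le.1 (hM a i j)
  exact ⟨P, hP⟩

/-- Convergence in `GL` requires convergence of the inverses too; both families have bounded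
entries, and their limits are mutually inverse. -/
theorem exists_tendsto_isometry {α : Type*} (u : Ultrafilter α) {A : α → isometryGroup d} {T : ℝ}
    (hT : ∀ a, (A a).1.val.mulVec (basePoint d) (Sum.inr 1) ≤ T) :
    ∃ B : isometryGroup d, Tendsto A u (𝓝 B) := by
  obtain ⟨P, hP⟩ := exists_tendsto_matrix u fun a => abs_entry_le (A a).2 (hT a)
  obtain ⟨Q, hQ⟩ := exists_tendsto_matrix u fun a => abs_entry_le (inv_mem (A a).2)
    ((time_inv_mulVec_basePoint (A a).2).trans_le (hT a))
  have hPQ : P * Q = 1 := tendsto_nhds_unique (hP.mul hQ) <| by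
    simp only [← Units.val_mul, mul_inv_cancel, Units.val_one]
    exact tendsto_const_nhds
  have hQP : Q * P = 1 := tendsto_nhds_unique (hQ.mul hP) <| by
    simp only [← Units.val_mul, inv_mul_cancel, Units.val_one]
    exact tendsto_const_nhds
  have hlim : Tendsto (fun a => (A a).1) u (𝓝 ⟨P, Q, hPQ, hQP⟩) := by
    rw [Units.isInducing_embedProduct.tendsto_nhds_iff]
    exact hP.prodMk_nhds ((MulOpposite.continuous_op.tendsto Q).comp hQ)
  have hmem := isClosed_isometryGroup.mem_of_tendsto hlim (.of_forall fun a => (A a).2)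
  exact ⟨⟨_, hmem⟩, tendsto_subtype_rng.2 hlim⟩

/-! ## Euclidean similarities as isometries -/

/-- The linear map of Minkowski space that extends the similarity `w ↦ s w + v`. -/
def similarityLin (s : ℝ) (v : EuclideanSpace ℝ (Fin d)) : Minkowski d →ₗ[ℝ] Minkowski d where
  toFun u := Sum.elim (fun i => u (Sum.inl i) + (u (Sum.inr 1) - u (Sum.inr 0)) / s * v i)
    ![(s * (u (Sum.inr 1) + u (Sum.inr 0)) + 2 * ∑ i, u (Sum.inl i) * v i +
        (u (Sum.inr 1) - u (Sum.inr 0)) / s * (‖v‖ ^ 2 - 1)) / 2,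
      (s * (u (Sum.inr 1) + u (Sum.inr 0)) + 2 * ∑ i, u (Sum.inl i) * v i +
        (u (Sum.inr 1) - u (Sum.inr 0)) / s * (‖v‖ ^ 2 + 1)) / 2]
  map_add' u u' := by
    ext j
    rcases j with i | j
    · simp only [Pi.add_apply, Sum.elim_inl]
      ring
    · fin_cases j <;>
      · simp [add_mul, Finset.sum_add_distrib]
        ring
  map_smul' c u := by
    ext j
    rcases j with i | j
    · simp only [Pi.smul_apply, Sum.elim_inl, smul_eq_mul, RingHom.id_apply]
      ring
    · fin_cases j <;>
      · simp [mul_assoc, ← Finset.mul_sum]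
        ring

/-- With time minus and time plus last space coordinate as coordinates, the null vector of `x` is
`(x, 1, ‖x‖²)`. The map is the linear one sending it to `s⁻¹` times the same vector for `s x + v`.
-/
theorem similarityLin_inl (s : ℝ) (v : EuclideanSpace ℝ (Fin d)) (u : Minkowski d) (i : Fin d) :
    similarityLin s v u (Sum.inl i) =
      u (Sum.inl i) + (u (Sum.inr 1) - u (Sum.inr 0)) / s * v i := rfl

theorem similarityLin_sub (s : ℝ) (v : EuclideanSpace ℝ (Fin d)) (u : Minkowski d) :
    similarityLin s v u (Sum.inr 1) - similarityLin s v u (Sum.inr 0) =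
      (u (Sum.inr 1) - u (Sum.inr 0)) / s := by
  simp [similarityLin]
  ring

theorem similarityLin_add (s : ℝ) (v : EuclideanSpace ℝ (Fin d)) (u : Minkowski d) :
    similarityLin s v u (Sum.inr 1) + similarityLin s v u (Sum.inr 0) =
      s * (u (Sum.inr 1) + u (Sum.inr 0)) + 2 * ∑ i, u (Sum.inl i) * v i +
        (u (Sum.inr 1) - u (Sum.inr 0)) / s * ‖v‖ ^ 2 := by
  simp [similarityLin]
  ring

theorem minkowski_ext {u u' : Minkowski d} (h : ∀ i, u (Sum.inl i) = u' (Sum.inl i))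
    (hs : u (Sum.inr 1) - u (Sum.inr 0) = u' (Sum.inr 1) - u' (Sum.inr 0))
    (ha : u (Sum.inr 1) + u (Sum.inr 0) = u' (Sum.inr 1) + u' (Sum.inr 0)) : u = u' := by
  ext j
  rcases j with i | j
  · exact h i
  · fin_cases j
    · simp only [Fin.zero_eta]; linarith
    · simp only [Fin.mk_one]; linarith

theorem similarityLin_comp {s : ℝ} (hs : s ≠ 0) (v : EuclideanSpace ℝ (Fin d)) (u : Minkowski d) :
    similarityLin s v (similarityLin s⁻¹ (-(s⁻¹ • v)) u) = u := by
  refine minkowski_ext (fun i => ?_) ?_ ?_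
  · rw [similarityLin_inl, similarityLin_sub, similarityLin_inl]
    simp
    field_simp
    ring
  · rw [similarityLin_sub, similarityLin_sub]
    field_simp
  · have hn : ‖v‖ ^ 2 = ∑ i, v i * v i := by
      rw [EuclideanSpace.real_norm_sq_eq]
      simp only [pow_two]
    rw [similarityLin_add, similarityLin_sub, similarityLin_add]
    simp only [similarityLin_inl, PiLp.neg_apply, PiLp.smul_apply, smul_eq_mul, add_mul,
      Finset.sum_add_distrib, mul_neg, neg_mul, Finset.sum_neg_distrib, norm_neg, norm_smul,
      mul_pow, norm_inv, Real.norm_eq_abs, inv_pow, sq_abs]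
    simp only [mul_left_comm _ s⁻¹ _, mul_assoc, ← Finset.mul_sum, ← hn]
    field_simp
    ring

theorem lorentz_eq_mul_add_sub (u u' : Minkowski d) : lorentz u u' =
    ∑ i, u (Sum.inl i) * u' (Sum.inl i) -
      ((u (Sum.inr 1) - u (Sum.inr 0)) * (u' (Sum.inr 1) + u' (Sum.inr 0)) +
        (u' (Sum.inr 1) - u' (Sum.inr 0)) * (u (Sum.inr 1) + u (Sum.inr 0))) / 2 := by
  unfold lorentz
  ring

theorem lorentz_similarityLin {s : ℝ} (hs : s ≠ 0) (v : EuclideanSpace ℝ (Fin d))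
    (u u' : Minkowski d) :
    lorentz (similarityLin s v u) (similarityLin s v u') = lorentz u u' := by
  have hn : ‖v‖ ^ 2 = ∑ i, v i * v i := by
    rw [EuclideanSpace.real_norm_sq_eq]
    simp only [pow_two]
  rw [lorentz_eq_mul_add_sub, lorentz_eq_mul_add_sub u u', similarityLin_sub, similarityLin_sub,
    similarityLin_add, similarityLin_add]
  set p := (u (Sum.inr 1) - u (Sum.inr 0)) / s with hp
  set p' := (u' (Sum.inr 1) - u' (Sum.inr 0)) / s with hp'
  have hsum : ∑ i, similarityLin s v u (Sum.inl i) * similarityLin s v u' (Sum.inl i) =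
      ∑ i, u (Sum.inl i) * u' (Sum.inl i) + p' * ∑ i, u (Sum.inl i) * v i +
        p * ∑ i, u' (Sum.inl i) * v i + p * p' * ‖v‖ ^ 2 := by
    rw [hn]
    simp only [Finset.mul_sum, ← Finset.sum_add_distrib, similarityLin_inl, ← hp, ← hp']
    exact Finset.sum_congr rfl fun i _ => by ring
  have e : u (Sum.inr 1) - u (Sum.inr 0) = s * p := by rw [hp]; field_simp
  have e' : u' (Sum.inr 1) - u' (Sum.inr 0) = s * p' := by rw [hp']; field_simp
  rw [hsum, e, e']
  ring

theorem similarityLin_mem_hyperboloid {s : ℝ} (hs : 0 < s) (v : EuclideanSpace ℝ (Fin d))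
    {u : Minkowski d} (hu : u ∈ hyperboloid d) : similarityLin s v u ∈ hyperboloid d := by
  -- The sheet is detected by the sign of time minus last space coordinate, which `similarityLin`
  -- merely divides by `s`.
  have key (w : Minkowski d) (hw : lorentz w w = -1) :
      0 < w (Sum.inr 1) ↔ 0 < w (Sum.inr 1) - w (Sum.inr 0) := by
    have h := lorentz_eq_mul_add_sub w w
    have hnn : 0 ≤ ∑ i : Fin d, w (Sum.inl i) * w (Sum.inl i) :=
      Finset.sum_nonneg fun i _ => mul_self_nonneg _
    have hpos : 0 < (w (Sum.inr 1) - w (Sum.inr 0)) * (w (Sum.inr 1) + w (Sum.inr 0)) := by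
      linarith
    rcases mul_pos_iff.1 hpos with ⟨h1, h2⟩ | ⟨h1, h2⟩ <;> constructor <;> intro <;> linarith
  have hl : lorentz (similarityLin s v u) (similarityLin s v u) = -1 :=
    (lorentz_similarityLin hs.ne' v u u).trans hu.1
  refine ⟨hl, (key _ hl).2 ?_⟩
  rw [similarityLin_sub]
  exact div_pos ((key _ hu.1).1 hu.2) hs

/-- The similarity `w ↦ s w + v` as an isometry of hyperbolic space. -/
def similarity (s : ℝ) (hs : 0 < s) (v : EuclideanSpace ℝ (Fin d)) : isometryGroup d where
  val := ⟨LinearMap.toMatrix' (similarityLin s v),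
    LinearMap.toMatrix' (similarityLin s⁻¹ (-(s⁻¹ • v))), by
      rw [← LinearMap.toMatrix'_comp, ← LinearMap.toMatrix'_id]
      exact congrArg _ (LinearMap.ext (similarityLin_comp hs.ne' v)), by
      rw [← LinearMap.toMatrix'_comp, ← LinearMap.toMatrix'_id]
      refine congrArg _ (LinearMap.ext fun u => ?_)
      have h := similarityLin_comp (inv_ne_zero hs.ne') (-(s⁻¹ • v)) u
      simpa [smul_smul, hs.ne'] using h⟩
  property := by
    refine mem_isometryGroup_iff.2 ⟨fun u w => ?_, fun u hu => ⟨?_, ?_⟩⟩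
    · simp only [LinearMap.toMatrix'_mulVec]
      exact lorentz_similarityLin hs.ne' v u w
    · simp only [LinearMap.toMatrix'_mulVec]
      exact similarityLin_mem_hyperboloid hs v hu
    · simp only [Units.inv_mk, LinearMap.toMatrix'_mulVec]
      exact similarityLin_mem_hyperboloid (inv_pos.2 hs) _ hu

theorem boundaryHom_similarity_coe {s : ℝ} (hs : 0 < s) (v w : EuclideanSpace ℝ (Fin d)) :
    boundaryHom d (similarity s hs v) (w : Boundary d) =
      ((s • w + v : EuclideanSpace ℝ (Fin d)) : Boundary d) := by
  have hn : ‖s • w + v‖ ^ 2 = s ^ 2 * ‖w‖ ^ 2 + 2 * s * ∑ i, w i * v i + ‖v‖ ^ 2 := by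
    simp only [EuclideanSpace.real_norm_sq_eq, Finset.mul_sum, ← Finset.sum_add_distrib]
    refine Finset.sum_congr rfl fun i _ => ?_
    simp
    ring
  refine boundaryFun_eq _ (inv_pos.2 hs) ?_
  simp only [similarity, LinearMap.toMatrix'_mulVec]
  refine minkowski_ext (fun i => ?_) ?_ ?_
  · rw [similarityLin_inl]
    simp [nullVector_coe]
    field_simp
    ring
  · rw [similarityLin_sub]
    simp [nullVector_coe]
    field_simp
    ring
  · rw [similarityLin_add]
    simp [nullVector_coe, hn]
    field_simp
    ring

theorem boundaryHom_similarity_infty {s : ℝ} (hs : 0 < s) (v : EuclideanSpace ℝ (Fin d)) :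
    boundaryHom d (similarity s hs v) OnePoint.infty = OnePoint.infty := by
  refine boundaryFun_eq _ hs ?_
  simp only [similarity, LinearMap.toMatrix'_mulVec]
  refine minkowski_ext (fun i => ?_) ?_ ?_
  · rw [similarityLin_inl]
    simp [nullVector_infty]
  · rw [similarityLin_sub]
    simp [nullVector_infty]
  · rw [similarityLin_add]
    simp [nullVector_infty]
    ring

/-! ## Convergence of homeomorphisms of the boundary -/

section Convergence

variable {α : Type*} {l : Filter α}

theorem isInducing_homeoTopology (d : ℕ) : IsInducing
    fun g : Boundary d ≃ₜ Boundary d => (⟨g, g.continuous⟩ : C(Boundary d, Boundary d)) := ⟨rfl⟩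

theorem tendsto_homeo_mul {a b : α → Boundary d ≃ₜ Boundary d} {x y : Boundary d ≃ₜ Boundary d}
    (ha : Tendsto a l (𝓝 x)) (hb : Tendsto b l (𝓝 y)) :
    Tendsto (fun i => a i * b i) l (𝓝 (x * y)) := by
  rw [(isInducing_homeoTopology d).tendsto_nhds_iff] at ha hb ⊢
  exact (ContinuousMap.continuous_comp'.tendsto (_, _)).comp (hb.prodMk_nhds ha)

theorem tendsto_homeo_of_forall {g : α → Boundary d ≃ₜ Boundary d} {g₀ : Boundary d ≃ₜ Boundary d}
    (h : ∀ ξ, Tendsto (fun p : α × Boundary d => g p.1 p.2) (l ×ˢ 𝓝 ξ) (𝓝 (g₀ ξ))) :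
    Tendsto g l (𝓝 g₀) := by
  rw [(isInducing_homeoTopology d).tendsto_nhds_iff, ContinuousMap.tendsto_nhds_compactOpen]
  intro K hK U hU hm
  have key : ∀ s ⊆ K, IsCompact s → ∀ᶠ a in l, Set.MapsTo (g a) s U := by
    intro s hsK hs
    refine hs.induction_on (p := fun s => ∀ᶠ a in l, Set.MapsTo (g a) s U) ?_ ?_ ?_ ?_
    · exact .of_forall fun a => Set.mapsTo_empty _ _
    · exact fun s t hst ht => ht.mono fun a ha => ha.mono_left hst
    · exact fun s t hs ht => (hs.and ht).mono fun a ha => ha.1.union ha.2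
    · intro ξ hξ
      have hev := (h ξ).eventually (hU.mem_nhds (hm (hsK hξ)))
      obtain ⟨pa, hpa, pb, hpb, hab⟩ := eventually_prod_iff.1 hev
      exact ⟨{η | pb η}, mem_nhdsWithin_of_mem_nhds hpb, hpa.mono fun a ha η hη => hab ha hη⟩
  exact key K subset_rfl hK

/-- Near `∞` bounded displacement alone suffices, since both the maps and the limit fix `∞`;
closeness to `c` is needed only on bounded sets. -/
theorem tendsto_translation {g : α → Boundary d ≃ₜ Boundary d}
    {γ : α → EuclideanSpace ℝ (Fin d) → EuclideanSpace ℝ (Fin d)} {c : EuclideanSpace ℝ (Fin d)}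
    {M : ℝ} (hinf : ∀ a, g a OnePoint.infty = OnePoint.infty)
    (hcoe : ∀ a (w : EuclideanSpace ℝ (Fin d)), g a (w : Boundary d) = (γ a w : Boundary d))
    (hM : ∀ᶠ a in l, ∀ w, ‖γ a w - w‖ ≤ M)
    (hc : ∀ R ε : ℝ, 0 < ε → ∀ᶠ a in l, ∀ w, ‖w‖ ≤ R → ‖γ a w - w - c‖ ≤ ε) :
    Tendsto g l (𝓝 (translation c)) := by
  refine tendsto_homeo_of_forall fun ξ => ?_
  induction ξ using OnePoint.rec with
  | infty =>
    have h0 : translation c (OnePoint.infty : Boundary d) = OnePoint.infty := rfl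
    rw [h0]
    intro U hU
    rw [OnePoint.nhds_infty_eq, Filter.coclosedCompact_eq_cocompact,
      ← Metric.cobounded_eq_cocompact] at hU
    obtain ⟨hU1, hU2⟩ := hU
    obtain ⟨r, -, hr⟩ := (hasBasis_cobounded_norm (E := EuclideanSpace ℝ (Fin d))).mem_iff.1 hU1
    have hV : {η : Boundary d | η = OnePoint.infty ∨
        ∃ w : EuclideanSpace ℝ (Fin d), r + M ≤ ‖w‖ ∧ η = w} ∈
        𝓝 (OnePoint.infty : Boundary d) := by
      rw [OnePoint.nhds_infty_eq, Filter.coclosedCompact_eq_cocompact,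
        ← Metric.cobounded_eq_cocompact]
      refine ⟨?_, Or.inl rfl⟩
      exact Filter.mem_map.2 <| hasBasis_cobounded_norm.mem_iff.2
        ⟨r + M, trivial, fun w hw => Or.inr ⟨w, hw, rfl⟩⟩
    refine Filter.mem_map.2 (Filter.mem_of_superset (Filter.prod_mem_prod hM hV) ?_)
    rintro ⟨a, η⟩ ⟨ha, rfl | ⟨w, hw, rfl⟩⟩
    · simpa [hinf] using hU2
    · simp only [Set.mem_preimage, hcoe]
      refine hr (show r ≤ ‖γ a w‖ from ?_)
      have h1 := norm_sub_norm_le w (γ a w)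
      rw [norm_sub_rev] at h1
      linarith [ha w]
  | coe x =>
    have h0 : translation c (x : Boundary d) = ((x + c : EuclideanSpace ℝ (Fin d)) : Boundary d) :=
      rfl
    rw [h0, OnePoint.nhds_coe_eq]
    have hlim : Tendsto (fun p : α × EuclideanSpace ℝ (Fin d) => γ p.1 p.2) (l ×ˢ 𝓝 x)
        (𝓝 (x + c)) := by
      have h1 : Tendsto (fun p : α × EuclideanSpace ℝ (Fin d) => γ p.1 p.2 - p.2 - c) (l ×ˢ 𝓝 x)
          (𝓝 0) := by
        rw [Metric.tendsto_nhds]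
        intro ε hε
        have hb : ∀ᶠ w in 𝓝 x, ‖w‖ ≤ ‖x‖ + 1 :=
          (continuous_norm.tendsto x).eventually (Iic_mem_nhds (lt_add_one _))
        filter_upwards [(hc (‖x‖ + 1) (ε / 2) (half_pos hε)).prod_mk hb] with p hp
        rw [dist_zero_right]
        exact (hp.1 p.2 hp.2).trans_lt (half_lt_self hε)
      have h2 := (h1.add (tendsto_snd (f := l) (g := 𝓝 x))).add_const c
      convert h2 using 2
      · abel
      · rw [zero_add]
    rw [(OnePoint.isOpenEmbedding_coe).map_nhds_eq]
    have h3 := ((OnePoint.continuous_coe).tendsto (x + c)).comp hlim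
    have h4 : l ×ˢ 𝓝 (x : Boundary d) = Filter.map (Prod.map id ((↑) :
        EuclideanSpace ℝ (Fin d) → Boundary d)) (l ×ˢ 𝓝 x) := by
      rw [OnePoint.nhds_coe_eq, ← Filter.prod_map_map_eq', Filter.map_id]
    rw [h4, Filter.tendsto_map'_iff]
    refine h3.congr fun p => ?_
    simp [hcoe]

/-- The displacement of the inverse at `w` is minus that of the map at the preimage of `w`, which
lies within `M` of `w`. -/
theorem tendsto_inv_translation {g : α → Boundary d ≃ₜ Boundary d}
    {γ : α → EuclideanSpace ℝ (Fin d) → EuclideanSpace ℝ (Fin d)} {c : EuclideanSpace ℝ (Fin d)}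
    {M : ℝ} (hinf : ∀ a, g a OnePoint.infty = OnePoint.infty)
    (hcoe : ∀ a (w : EuclideanSpace ℝ (Fin d)), g a (w : Boundary d) = (γ a w : Boundary d))
    (hM : ∀ᶠ a in l, ∀ w, ‖γ a w - w‖ ≤ M)
    (hc : ∀ R ε : ℝ, 0 < ε → ∀ᶠ a in l, ∀ w, ‖w‖ ≤ R → ‖γ a w - w - c‖ ≤ ε) :
    Tendsto (fun a => (g a)⁻¹) l (𝓝 (translation (-c))) := by
  have hinv (a) : (g a)⁻¹ OnePoint.infty = OnePoint.infty :=
    (g a).injective ((show g a ((g a).symm OnePoint.infty) = _ from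
      (g a).apply_symm_apply _).trans (hinf a).symm)
  have hex (a) (w : EuclideanSpace ℝ (Fin d)) :
      ∃ u : EuclideanSpace ℝ (Fin d), (g a)⁻¹ (w : Boundary d) = u := by
    have hne : (g a)⁻¹ (w : Boundary d) ≠ OnePoint.infty := fun h =>
      OnePoint.coe_ne_infty w ((g a)⁻¹.injective (h.trans (hinv a).symm))
    obtain ⟨u, hu⟩ := OnePoint.ne_infty_iff_exists.1 hne
    exact ⟨u, hu.symm⟩
  choose δ hδ using hex
  have hγδ (a w) : γ a (δ a w) = w := by
    refine OnePoint.coe_injective ?_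
    rw [← hcoe, ← hδ]
    exact (g a).apply_symm_apply _
  refine tendsto_translation (M := M) hinv hδ ?_ fun R ε hε => ?_
  · filter_upwards [hM] with a ha w
    have h := ha (δ a w)
    rwa [hγδ, norm_sub_rev] at h
  · filter_upwards [hM, hc (R + M) ε hε] with a ha ha' w hw
    have h := ha (δ a w)
    rw [hγδ] at h
    have h' := ha' (δ a w) <| by
      have := norm_sub_norm_le (δ a w) w
      rw [norm_sub_rev] at this
      linarith
    rw [hγδ, ← norm_neg] at h'
    rwa [show δ a w - w - -c = -(w - δ a w - c) by abel]

theorem continuous_translation : Continuous (translation (d := d)) := by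
  refine continuous_iff_continuousAt.2 fun c => ?_
  refine tendsto_translation (γ := fun b w => w + b) (M := ‖c‖ + 1) (fun _ => rfl)
    (fun _ _ => rfl) ?_ fun R ε hε => ?_
  · filter_upwards [(continuous_norm.tendsto c).eventually (Iic_mem_nhds (lt_add_one _))]
      with b hb w
    simpa using hb
  · filter_upwards [Metric.closedBall_mem_nhds c hε] with b hb w _
    simpa [dist_eq_norm] using hb

theorem translation_add (b c : EuclideanSpace ℝ (Fin d)) :
    translation (b + c) = translation b * translation c := by
  refine Homeomorph.ext fun ξ => ?_
  induction ξ using OnePoint.rec with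
  | infty => rfl
  | coe x => exact congrArg _ (show x + (b + c) = x + c + b by abel)

theorem translation_ne_one {b : EuclideanSpace ℝ (Fin d)} (hb : b ≠ 0) : translation b ≠ 1 := by
  intro h
  have h0 : translation b ((0 : EuclideanSpace ℝ (Fin d)) : Boundary d) =
      ((0 : EuclideanSpace ℝ (Fin d)) : Boundary d) := by rw [h]; rfl
  have h1 : (0 + b : EuclideanSpace ℝ (Fin d)) = 0 := OnePoint.coe_injective h0
  exact hb (by simpa using h1)

end Convergence

/-! ## The displacement of `f` and of its iterates -/

section Displacement

variable {E : Type*} [SeminormedAddCommGroup E] {γ : E → E}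

theorem norm_iterate_sub_le {M : ℝ} (hM : ∀ w, ‖γ w - w‖ ≤ M) (m : ℕ) (u : E) :
    ‖γ^[m] u - u‖ ≤ m * M := by
  induction m with
  | zero => simp
  | succ m ih =>
    rw [Function.iterate_succ_apply', ← sub_add_sub_cancel _ (γ^[m] u) u]
    refine (norm_add_le _ _).trans ((add_le_add (hM _) ih).trans_eq ?_)
    push_cast
    ring

/-- The crude bound `M` per step keeps the orbit in the ball of radius `ρ`, where every step is `b`
up to `ε`; the errors add. -/
theorem norm_iterate_sub_sub_le {M ε ρ r : ℝ} {v b : E} (hM : ∀ w, ‖γ w - w‖ ≤ M)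
    (hb : ∀ u, ‖u - v‖ ≤ ρ → ‖γ u - u - b‖ ≤ ε) {m : ℕ} (hm : m * M + r ≤ ρ) {u : E}
    (hu : ‖u - v‖ ≤ r) : ‖γ^[m] u - u - m • b‖ ≤ m * ε := by
  have hM0 : 0 ≤ M := (norm_nonneg _).trans (hM u)
  induction m with
  | zero => simp
  | succ m ih =>
    push_cast at hm
    have h1 : ‖γ^[m] u - v‖ ≤ ρ := by
      rw [← sub_add_sub_cancel _ u v]
      refine (norm_add_le _ _).trans ((add_le_add (norm_iterate_sub_le hM m u) hu).trans ?_)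
      linarith
    have h2 : γ^[m + 1] u - u - (m + 1) • b =
        (γ (γ^[m] u) - γ^[m] u - b) + (γ^[m] u - u - m • b) := by
      rw [Function.iterate_succ_apply', succ_nsmul]
      abel
    rw [h2]
    refine (norm_add_le _ _).trans ((add_le_add (hb _ h1) (ih (by linarith))).trans_eq ?_)
    push_cast
    ring

end Displacement

/-! ### Bounds on `Φ` and on the displacement of `f` near `s² w₀`. -/

variable {Φ : EuclideanSpace ℝ (Fin d) → EuclideanSpace ℝ (Fin d)}

theorem HasAngularLipschitzBound.continuousAt (h : HasAngularLipschitzBound Φ)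
    {w : EuclideanSpace ℝ (Fin d)} (hw : w ≠ 0) : ContinuousAt Φ w := by
  obtain ⟨C, δ, hδ, h⟩ := h
  have hw' : 0 < ‖w‖ := norm_pos_iff.2 hw
  rw [ContinuousAt, tendsto_iff_norm_sub_tendsto_zero]
  have hlim : Tendsto (fun u => C * (‖u - w‖ / ‖w‖)) (𝓝 w) (𝓝 0) := by
    have : Continuous fun u => C * (‖u - w‖ / ‖w‖) := by fun_prop
    simpa using this.tendsto w
  refine squeeze_zero' (.of_forall fun _ => norm_nonneg _) ?_ hlim
  filter_upwards [Metric.closedBall_mem_nhds w (mul_pos hδ hw')] with u hu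
  simpa using h w (u - w) hw (by simpa [dist_eq_norm] using hu)

theorem HasAngularLipschitzBound.exists_norm_le (h : HasAngularLipschitzBound Φ)
    (hom : HomogeneousDegreeZero Φ) : ∃ C, ∀ w, w ≠ 0 → ‖Φ w‖ ≤ C := by
  obtain ⟨C, hC⟩ := (isCompact_sphere (0 : EuclideanSpace ℝ (Fin d)) 1).exists_bound_of_continuousOn
    (f := Φ) fun w hw => (h.continuousAt
      (ne_zero_of_mem_unit_sphere (⟨w, hw⟩ : Metric.sphere _ _))).continuousWithinAt
  refine ⟨C, fun w hw => ?_⟩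
  have hw' : 0 < ‖w‖ := norm_pos_iff.2 hw
  rw [← hom ‖w‖⁻¹ (inv_pos.2 hw') w hw]
  exact hC _ (by simp [norm_smul, hw'.ne'])

/-- A homeomorphism with an expansion at infinity restricts to a continuous map of Euclidean
space, with the same expansion. -/
theorem HasExpansionAtInfinity.exists_euclidean [Nontrivial (EuclideanSpace ℝ (Fin d))]
    {f : Boundary d ≃ₜ Boundary d} (hf : HasExpansionAtInfinity f Φ)
    (hb : ∃ C, ∀ w, w ≠ 0 → ‖Φ w‖ ≤ C) :
    f OnePoint.infty = OnePoint.infty ∧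
    ∃ γ : EuclideanSpace ℝ (Fin d) → EuclideanSpace ℝ (Fin d),
      (∀ w : EuclideanSpace ℝ (Fin d), f (w : Boundary d) = (γ w : Boundary d)) ∧
      (∀ ε : ℝ, 0 < ε → ∃ r : ℝ, ∀ w, r ≤ ‖w‖ → ‖γ w - (w + Φ w)‖ ≤ ε) ∧
      ∃ M : ℝ, ∀ w, ‖γ w - w‖ ≤ M := by
  obtain ⟨f₀, hf₀, hlim⟩ := hf
  obtain ⟨C, hC⟩ := hb
  have hcoe : Tendsto ((↑) : EuclideanSpace ℝ (Fin d) → Boundary d) (Bornology.cobounded _)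
      (𝓝 OnePoint.infty) := by
    rw [Metric.cobounded_eq_cocompact, ← Filter.coclosedCompact_eq_cocompact]
    exact OnePoint.tendsto_coe_infty
  have hne : ∀ᶠ w : EuclideanSpace ℝ (Fin d) in Bornology.cobounded _, w ≠ 0 :=
    (tendsto_norm_cobounded_atTop.eventually_gt_atTop 0).mono fun w hw => norm_pos_iff.1 hw
  have hlim' : ∀ ε : ℝ, 0 < ε → ∀ᶠ w in Bornology.cobounded _, ‖f₀ w - (w + Φ w)‖ ≤ ε := by
    intro ε hε
    filter_upwards [Metric.tendsto_nhds.1 hlim ε hε] with w hw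
    rw [dist_zero_right] at hw
    exact hw.le
  have hf₀inf : Tendsto f₀ (Bornology.cobounded _) (Bornology.cobounded _) := by
    rw [← tendsto_norm_atTop_iff_cobounded]
    refine tendsto_atTop_mono' _ ?_
      (tendsto_atTop_add_const_right _ (-(1 + C)) tendsto_norm_cobounded_atTop)
    filter_upwards [hlim' 1 one_pos, hne] with w hw hw0
    have h1 : w = f₀ w - (f₀ w - (w + Φ w)) - Φ w := by abel
    have h2 : ‖w‖ ≤ ‖f₀ w‖ + ‖f₀ w - (w + Φ w)‖ + ‖Φ w‖ := by
      conv_lhs => rw [h1]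
      exact (norm_sub_le _ _).trans (add_le_add_left (norm_sub_le _ _) _)
    linarith [hC w hw0]
  -- `f` is continuous and its finite values tend to `∞`; uniqueness of the limit uses that the
  -- space is unbounded, hence `Nontrivial`.
  have hinf : f OnePoint.infty = OnePoint.infty := by
    refine tendsto_nhds_unique ((f.continuous.tendsto _).comp hcoe)
      ((hcoe.comp hf₀inf).congr' ?_)
    filter_upwards [hf₀] with w hw
    exact hw.symm
  refine ⟨hinf, ?_⟩
  have hex (w : EuclideanSpace ℝ (Fin d)) :
      ∃ u : EuclideanSpace ℝ (Fin d), f (w : Boundary d) = u := by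
    have hne : f (w : Boundary d) ≠ OnePoint.infty := fun h =>
      OnePoint.coe_ne_infty w (f.injective (h.trans hinf.symm))
    obtain ⟨u, hu⟩ := OnePoint.ne_infty_iff_exists.1 hne
    exact ⟨u, hu.symm⟩
  choose γ hγ using hex
  have hγ₀ : ∀ᶠ w in Bornology.cobounded _, γ w = f₀ w :=
    hf₀.mono fun w hw => OnePoint.coe_injective ((hγ w).symm.trans hw)
  have hexp : ∀ ε : ℝ, 0 < ε → ∃ r : ℝ, ∀ w, r ≤ ‖w‖ → ‖γ w - (w + Φ w)‖ ≤ ε := by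
    intro ε hε
    obtain ⟨r, -, hr⟩ := hasBasis_cobounded_norm.eventually_iff.1 ((hlim' ε hε).and hγ₀)
    refine ⟨r, fun w hw => ?_⟩
    obtain ⟨h1, h2⟩ := hr hw
    rwa [h2]
  refine ⟨γ, hγ, hexp, ?_⟩
  have hcont : Continuous γ := by
    rw [OnePoint.isOpenEmbedding_coe.isInducing.continuous_iff]
    exact (f.continuous.comp OnePoint.continuous_coe).congr hγ
  obtain ⟨r, hr⟩ := hexp 1 one_pos
  -- Compactness bounds the displacement on this ball, the expansion outside; radius at least `1`
  -- excludes `w = 0`, where `Φ` is uncontrolled.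
  obtain ⟨M, hM⟩ := (isCompact_closedBall (0 : EuclideanSpace ℝ (Fin d))
    (max r 1)).exists_bound_of_continuousOn (hcont.sub continuous_id).continuousOn
  refine ⟨max M (1 + C), fun w => ?_⟩
  rcases le_total ‖w‖ (max r 1) with h | h
  · exact (hM w (by simpa using h)).trans (le_max_left _ _)
  · have hw0 : w ≠ 0 := norm_pos_iff.1 (zero_lt_one.trans_le ((le_max_right _ _).trans h))
    refine le_trans ?_ (le_max_right _ _)
    rw [show γ w - w = γ w - (w + Φ w) + Φ w by abel]
    exact (norm_add_le _ _).trans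
      (add_le_add (hr w ((le_max_left _ _).trans h)) (hC w hw0))

theorem eventually_displacement_near {γ : EuclideanSpace ℝ (Fin d) → EuclideanSpace ℝ (Fin d)}
    (hexp : ∀ ε : ℝ, 0 < ε → ∃ r : ℝ, ∀ w, r ≤ ‖w‖ → ‖γ w - (w + Φ w)‖ ≤ ε)
    (hom : HomogeneousDegreeZero Φ) (hlip : HasAngularLipschitzBound Φ)
    {w₀ : EuclideanSpace ℝ (Fin d)} (hw₀ : w₀ ≠ 0) (R : ℝ) {ε : ℝ} (hε : 0 < ε) :
    ∀ᶠ s : ℝ in atTop, ∀ u, ‖u - s ^ 2 • w₀‖ ≤ R * s → ‖γ u - u - Φ w₀‖ ≤ ε := by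
  obtain ⟨r, hr⟩ := hexp (ε / 2) (half_pos hε)
  obtain ⟨C, δ, hδ, hC⟩ := hlip
  have hw : 0 < ‖w₀‖ := norm_pos_iff.2 hw₀
  -- The three thresholds make the angular bound applicable, make its value at most `ε / 2`, and
  -- keep the ball outside radius `r`.
  have h2 : ∀ᶠ s : ℝ in atTop, |R| / (δ * ‖w₀‖) ≤ s := eventually_ge_atTop _
  have h3 : ∀ᶠ s : ℝ in atTop, |C| * |R| / (ε / 2 * ‖w₀‖) ≤ s := eventually_ge_atTop _
  have h4 : ∀ᶠ s : ℝ in atTop, |r| / ‖w₀‖ + |R| / ‖w₀‖ ≤ s := eventually_ge_atTop _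
  filter_upwards [h2, h3, h4, eventually_ge_atTop 1] with s h2 h3 h4 hs u hu
  have hs0 : 0 < s := zero_lt_one.trans_le hs
  rw [div_le_iff₀ (by positivity)] at h2 h3
  rw [← add_div, div_le_iff₀ hw] at h4
  have hn : ‖s ^ 2 • w₀‖ = s ^ 2 * ‖w₀‖ := by
    rw [norm_smul, Real.norm_of_nonneg (by positivity)]
  have hu' : ‖u - s ^ 2 • w₀‖ ≤ |R| * s :=
    hu.trans (mul_le_mul_of_nonneg_right (le_abs_self R) hs0.le)
  have hru : r ≤ ‖u‖ := by
    have := norm_sub_norm_le (s ^ 2 • w₀) u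
    rw [norm_sub_rev, hn] at this
    have h5 : (|r| + |R|) * s ≤ s * ‖w₀‖ * s := mul_le_mul_of_nonneg_right h4 hs0.le
    nlinarith [le_abs_self r, abs_nonneg r]
  have hΦ : ‖Φ u - Φ w₀‖ ≤ ε / 2 := by
    have h5 := hC (s ^ 2 • w₀) (u - s ^ 2 • w₀) (smul_ne_zero (by positivity) hw₀) <| by
      rw [hn]
      nlinarith
    rw [add_sub_cancel, hom _ (by positivity) _ hw₀, hn] at h5
    refine h5.trans ?_
    have h6 : C * (‖u - s ^ 2 • w₀‖ / (s ^ 2 * ‖w₀‖)) ≤ |C| * (|R| * s / (s ^ 2 * ‖w₀‖)) :=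
      mul_le_mul (le_abs_self C) (by gcongr) (by positivity) (abs_nonneg C)
    refine h6.trans ?_
    rw [← mul_div_assoc, div_le_iff₀ (by positivity)]
    nlinarith
  rw [show γ u - u - Φ w₀ = γ u - (u + Φ u) + (Φ u - Φ w₀) by abel]
  exact (norm_add_le _ _).trans ((add_le_add (hr u hru) hΦ).trans_eq (add_halves ε))

/-! ## Rescaled iterates converge to translations -/

/-- The renormalized iterate `β⁻¹ f^⌊ts⌋ β` with `β w = s w + s² w₀`. -/
def rescaledIterate (f : Boundary d ≃ₜ Boundary d) (w₀ : EuclideanSpace ℝ (Fin d)) (t : ℝ)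
    (s : ℝ) (hs : 0 < s) : Boundary d ≃ₜ Boundary d :=
  (boundaryHom d (similarity s hs (s ^ 2 • w₀)))⁻¹ * f ^ ⌊t * s⌋₊ *
    boundaryHom d (similarity s hs (s ^ 2 • w₀))

theorem homeo_pow_apply_infty {f : Boundary d ≃ₜ Boundary d}
    (hinf : f OnePoint.infty = OnePoint.infty) (m : ℕ) :
    (f ^ m) OnePoint.infty = OnePoint.infty := by
  induction m with
  | zero => rfl
  | succ m ih => rw [pow_succ', Homeomorph.mul_apply, ih, hinf]

theorem homeo_pow_apply_coe {f : Boundary d ≃ₜ Boundary d}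
    {γ : EuclideanSpace ℝ (Fin d) → EuclideanSpace ℝ (Fin d)}
    (hγ : ∀ w : EuclideanSpace ℝ (Fin d), f (w : Boundary d) = (γ w : Boundary d)) (m : ℕ)
    (w : EuclideanSpace ℝ (Fin d)) : (f ^ m) (w : Boundary d) = (γ^[m] w : Boundary d) := by
  induction m with
  | zero => rfl
  | succ m ih => rw [pow_succ', Homeomorph.mul_apply, ih, hγ, Function.iterate_succ_apply']

theorem homeo_inv_apply_eq {g : Boundary d ≃ₜ Boundary d} {ξ η : Boundary d} (h : g η = ξ) :
    g⁻¹ ξ = η := g.symm_apply_eq.2 h.symm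

theorem rescaledIterate_infty {f : Boundary d ≃ₜ Boundary d}
    (hinf : f OnePoint.infty = OnePoint.infty) (w₀ : EuclideanSpace ℝ (Fin d)) (t s : ℝ)
    (hs : 0 < s) : rescaledIterate f w₀ t s hs OnePoint.infty = OnePoint.infty := by
  rw [rescaledIterate, Homeomorph.mul_apply, Homeomorph.mul_apply, boundaryHom_similarity_infty,
    homeo_pow_apply_infty hinf]
  exact homeo_inv_apply_eq (boundaryHom_similarity_infty _ _)

theorem rescaledIterate_coe {f : Boundary d ≃ₜ Boundary d}
    {γ : EuclideanSpace ℝ (Fin d) → EuclideanSpace ℝ (Fin d)}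
    (hγ : ∀ w : EuclideanSpace ℝ (Fin d), f (w : Boundary d) = (γ w : Boundary d))
    (w₀ : EuclideanSpace ℝ (Fin d)) (t s : ℝ) (hs : 0 < s) (w : EuclideanSpace ℝ (Fin d)) :
    rescaledIterate f w₀ t s hs (w : Boundary d) =
      ((w + s⁻¹ • (γ^[⌊t * s⌋₊] (s • w + s ^ 2 • w₀) - (s • w + s ^ 2 • w₀)) :
        EuclideanSpace ℝ (Fin d)) : Boundary d) := by
  rw [rescaledIterate, Homeomorph.mul_apply, Homeomorph.mul_apply, boundaryHom_similarity_coe,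
    homeo_pow_apply_coe hγ]
  refine homeo_inv_apply_eq ?_
  rw [boundaryHom_similarity_coe, smul_add, smul_inv_smul₀ hs.ne']
  congr 1
  abel

theorem tendsto_rescaledIterate {f : Boundary d ≃ₜ Boundary d}
    {γ : EuclideanSpace ℝ (Fin d) → EuclideanSpace ℝ (Fin d)}
    (hinf : f OnePoint.infty = OnePoint.infty)
    (hγ : ∀ w : EuclideanSpace ℝ (Fin d), f (w : Boundary d) = (γ w : Boundary d))
    (hexp : ∀ ε : ℝ, 0 < ε → ∃ r : ℝ, ∀ w, r ≤ ‖w‖ → ‖γ w - (w + Φ w)‖ ≤ ε)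
    {M : ℝ} (hM : ∀ w, ‖γ w - w‖ ≤ M)
    (hom : HomogeneousDegreeZero Φ) (hlip : HasAngularLipschitzBound Φ)
    {w₀ : EuclideanSpace ℝ (Fin d)} (hw₀ : w₀ ≠ 0) {t : ℝ} (ht : 0 ≤ t)
    {α : Type*} {l : Filter α} {s : α → ℝ} (hs : ∀ a, 0 < s a) (hlim : Tendsto s l atTop) :
    Tendsto (fun a => rescaledIterate f w₀ t (s a) (hs a)) l (𝓝 (translation (t • Φ w₀))) ∧
    Tendsto (fun a => (rescaledIterate f w₀ t (s a) (hs a))⁻¹) l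
      (𝓝 (translation (-(t • Φ w₀)))) := by
  have hM0 : 0 ≤ M := (norm_nonneg _).trans (hM 0)
  have hfloor (a : α) : (⌊t * s a⌋₊ : ℝ) ≤ t * s a := Nat.floor_le (mul_nonneg ht (hs a).le)
  have h1 : ∀ᶠ a in l, ∀ w, ‖w + (s a)⁻¹ • (γ^[⌊t * s a⌋₊] (s a • w + s a ^ 2 • w₀) -
      (s a • w + s a ^ 2 • w₀)) - w‖ ≤ t * M := by
    refine .of_forall fun a w => ?_
    rw [add_sub_cancel_left, norm_smul, Real.norm_of_nonneg (inv_pos.2 (hs a)).le,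
      inv_mul_le_iff₀ (hs a)]
    refine (norm_iterate_sub_le hM _ _).trans ?_
    nlinarith [hfloor a]
  have h2 : ∀ R ε : ℝ, 0 < ε → ∀ᶠ a in l, ∀ w, ‖w‖ ≤ R →
      ‖w + (s a)⁻¹ • (γ^[⌊t * s a⌋₊] (s a • w + s a ^ 2 • w₀) -
        (s a • w + s a ^ 2 • w₀)) - w - t • Φ w₀‖ ≤ ε := by
    intro R ε hε
    -- At most `t s` step errors accumulate before division by `s`; `t + 1` also covers `t = 0`.
    have hε' : 0 < ε / 2 / (t + 1) := by positivity
    have hdiv : Tendsto (fun a => (⌊t * s a⌋₊ : ℝ) / s a * ‖Φ w₀‖ - t * ‖Φ w₀‖) l (𝓝 0) := by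
      have := (((tendsto_nat_floor_mul_div_atTop ht).comp hlim).mul_const ‖Φ w₀‖).sub_const
        (t * ‖Φ w₀‖)
      simpa using this
    filter_upwards [hlim.eventually (eventually_displacement_near hexp hom hlip hw₀
      (t * M + R) hε'), Metric.tendsto_nhds.1 hdiv (ε / 2) (half_pos hε)] with a ha hb w hw
    have hsa := hs a
    set m := ⌊t * s a⌋₊
    set u := s a • w + s a ^ 2 • w₀ with hu
    have hm : (m : ℝ) ≤ t * s a := hfloor a
    have h3 : ‖γ^[m] u - u - m • Φ w₀‖ ≤ m * (ε / 2 / (t + 1)) := by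
      refine norm_iterate_sub_sub_le (r := R * s a) hM ha (by nlinarith) ?_
      rw [hu, add_sub_cancel_right, norm_smul, Real.norm_of_nonneg hsa.le, mul_comm]
      exact mul_le_mul_of_nonneg_right hw hsa.le
    -- Two errors: the accumulated deviation from `Φ w₀`, and the rounding of `t s` to an integer.
    have h4 : w + (s a)⁻¹ • (γ^[m] u - u) - w - t • Φ w₀ =
        (s a)⁻¹ • (γ^[m] u - u - m • Φ w₀) + ((m : ℝ) / s a - t) • Φ w₀ := by
      rw [← Nat.cast_smul_eq_nsmul ℝ, div_eq_inv_mul]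
      module
    have h5 : ‖(s a)⁻¹ • (γ^[m] u - u - m • Φ w₀)‖ ≤ ε / 2 := by
      rw [norm_smul, Real.norm_of_nonneg (inv_pos.2 hsa).le, inv_mul_le_iff₀ hsa]
      refine h3.trans ?_
      rw [mul_div_assoc', div_le_iff₀ (by positivity)]
      nlinarith [mul_pos hsa hε]
    have h6 : ‖((m : ℝ) / s a - t) • Φ w₀‖ ≤ ε / 2 := by
      rw [dist_zero_right, ← sub_mul, norm_mul, norm_norm, ← norm_smul] at hb
      exact hb.le
    rw [h4]
    exact (norm_add_le _ _).trans ((add_le_add h5 h6).trans_eq (add_halves ε))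
  exact ⟨tendsto_translation (fun a => rescaledIterate_infty hinf _ _ _ _)
      (fun a => rescaledIterate_coe hγ _ _ _ _) h1 h2,
    tendsto_inv_translation (fun a => rescaledIterate_infty hinf _ _ _ _)
      (fun a => rescaledIterate_coe hγ _ _ _ _) h1 h2⟩

/-! ## Renormalization by a cocompact group -/

/-- Every family of isometries can be brought back to a compact set of isometries by boundary
maps from a cocompact group. -/
theorem IsCocompactKleinian.exists_tendsto {G : Subgroup (Boundary d ≃ₜ Boundary d)}
    (hG : IsCocompactKleinian G) {α : Type*} (u : Ultrafilter α) (B : α → isometryGroup d) :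
    ∃ (A : α → isometryGroup d) (H : isometryGroup d), (∀ a, boundaryHom d (A a) ∈ G) ∧
      Tendsto (fun a => (A a)⁻¹ * B a) u (𝓝 H) := by
  obtain ⟨Γ, hΓ, -, ⟨K, hK, -, hcov⟩, hΓG, -⟩ := hG
  -- `A` is chosen so that `A⁻¹ B` carries the base point into `K`, which bounds its displacement.
  choose A hAΓ k hk hAk using fun a => hcov _ (mulVec_mem_hyperboloid (B a).2 basePoint_mem)
  obtain ⟨T, hT⟩ := (hK.image (continuous_apply (Sum.inr 1 : Fin d ⊕ Fin 2))).bddAbove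
  have hbound (a : α) : ((⟨A a, hΓ (hAΓ a)⟩ : isometryGroup d)⁻¹ * B a).1.val.mulVec
      (basePoint d) (Sum.inr 1) ≤ T := by
    have : ((⟨A a, hΓ (hAΓ a)⟩ : isometryGroup d)⁻¹ * B a).1.val.mulVec (basePoint d) = k a := by
      rw [Subgroup.coe_mul, Units.val_mul, ← Matrix.mulVec_mulVec, ← hAk]
      exact inv_mulVec_mulVec _ _
    rw [this]
    exact hT ⟨k a, hk a, rfl⟩
  obtain ⟨H, hH⟩ := exists_tendsto_isometry u hbound
  refine ⟨fun a => ⟨A a, hΓ (hAΓ a)⟩, H, fun a => ?_, hH⟩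
  obtain ⟨g, hg, hgA⟩ := hΓG _ (hAΓ a)
  exact (IsBoundaryMap.eq_boundaryHom (A := ⟨A a, hΓ (hAΓ a)⟩) hgA) ▸ hg

theorem tendsto_conj_boundaryHom {α : Type*} {l : Filter α} {C : α → isometryGroup d}
    {H : isometryGroup d} (hC : Tendsto C l (𝓝 H)) {g : α → Boundary d ≃ₜ Boundary d}
    {g₀ : Boundary d ≃ₜ Boundary d} (hg : Tendsto g l (𝓝 g₀)) :
    Tendsto (fun a => boundaryHom d (C a) * g a * (boundaryHom d (C a))⁻¹) l
      (𝓝 (boundaryHom d H * g₀ * (boundaryHom d H)⁻¹)) := by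
  simp only [← map_inv]
  exact tendsto_homeo_mul (tendsto_homeo_mul ((continuous_boundaryHom.tendsto H).comp hC) hg)
    ((continuous_boundaryHom.tendsto H⁻¹).comp hC.inv)

theorem isNontrivialOneParameterSubgroup_conj_translation (h : Boundary d ≃ₜ Boundary d)
    {b : EuclideanSpace ℝ (Fin d)} (hb : b ≠ 0) :
    IsNontrivialOneParameterSubgroup fun t : ℝ => h * translation (t • b) * h⁻¹ where
  map_add s t := by
    rw [add_smul, translation_add]
    group
  continuous := continuous_iff_continuousAt.2 fun t =>
    tendsto_homeo_mul (tendsto_homeo_mul tendsto_const_nhds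
      ((continuous_translation.comp (continuous_id.smul continuous_const)).tendsto t))
      tendsto_const_nhds
  nontrivial := by
    refine ⟨1, fun h1 => translation_ne_one hb ?_⟩
    simpa [mul_inv_eq_one] using h1

/-- The similarity `b`, which may lie outside the group, cancels. -/
theorem conj_mem_sup_zpowers {G : Subgroup (Boundary d ≃ₜ Boundary d)}
    (f : Boundary d ≃ₜ Boundary d) {a : Boundary d ≃ₜ Boundary d} (ha : a ∈ G)
    (b : Boundary d ≃ₜ Boundary d) (m : ℕ) :
    (a⁻¹ * b) * (b⁻¹ * f ^ m * b) * (a⁻¹ * b)⁻¹ ∈ G ⊔ Subgroup.zpowers f := by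
  have : (a⁻¹ * b) * (b⁻¹ * f ^ m * b) * (a⁻¹ * b)⁻¹ = a⁻¹ * f ^ m * a := by group
  rw [this]
  have ha' : a ∈ G ⊔ Subgroup.zpowers f := Subgroup.mem_sup_left ha
  exact mul_mem (mul_mem (inv_mem ha')
    (pow_mem (Subgroup.mem_sup_right (Subgroup.mem_zpowers f)) m)) ha'

end HypBoundary

end

open HypBoundary in
/-- Hyperbolic space has dimension `N = d + 1 ≥ 3`. -/
theorem theorem1p1 (d : ℕ) (hd : 2 ≤ d)
    (G : Subgroup (HypBoundary.Boundary d ≃ₜ HypBoundary.Boundary d))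
    (hG : HypBoundary.IsCocompactKleinian G)
    (f : HypBoundary.Boundary d ≃ₜ HypBoundary.Boundary d)
    (Φ : EuclideanSpace ℝ (Fin d) → EuclideanSpace ℝ (Fin d))
    (hf : HypBoundary.HasExpansionAtInfinity f Φ)
    (hΦ_hom : HypBoundary.HomogeneousDegreeZero Φ)
    (hΦ_ne : ∃ w, w ≠ 0 ∧ Φ w ≠ 0)
    (hΦ_lip : HypBoundary.HasAngularLipschitzBound Φ) :
    ∃ F : ℝ → (HypBoundary.Boundary d ≃ₜ HypBoundary.Boundary d),
      HypBoundary.IsNontrivialOneParameterSubgroup F ∧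
      (∀ t : ℝ, F t ∈ HypBoundary.closedGroupGenerated G f) ∧
      HypBoundary.IsConformallyConjugateToTranslations F := by
  obtain ⟨w₀, hw₀, hΦw₀⟩ := hΦ_ne
  have : Nontrivial (EuclideanSpace ℝ (Fin d)) := ⟨w₀, 0, hw₀⟩
  obtain ⟨hinf, γ, hγ, hexp, M, hM⟩ := hf.exists_euclidean (hΦ_lip.exists_norm_le hΦ_hom)
  let s : ℕ → ℝ := fun n => (n : ℝ) + 1
  have hs (n : ℕ) : 0 < s n := Nat.cast_add_one_pos n
  -- One ultrafilter, chosen before `t`, gives the same limit `H` for all `t`.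
  let u : Ultrafilter ℕ := hyperfilter ℕ
  have hlim : Tendsto s u atTop :=
    (tendsto_atTop_add_const_right _ 1 tendsto_natCast_atTop_atTop).mono_left
      Nat.hyperfilter_le_atTop
  obtain ⟨A, H, hAG, hH⟩ := hG.exists_tendsto u fun n => similarity (s n) (hs n) (s n ^ 2 • w₀)
  refine ⟨fun t => boundaryHom d H * translation (t • Φ w₀) * (boundaryHom d H)⁻¹,
    isNontrivialOneParameterSubgroup_conj_translation _ hΦw₀, fun t => ?_,
    (boundaryHom d H)⁻¹, ⟨H⁻¹, (H⁻¹).2, ?_⟩, Φ w₀, fun t => by rw [inv_inv]⟩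
  · have hmem (t : ℝ) (n : ℕ) := conj_mem_sup_zpowers f (hAG n)
      (boundaryHom d (similarity (s n) (hs n) (s n ^ 2 • w₀))) ⌊t * s n⌋₊
    simp only [← map_inv (boundaryHom d) (A _), ← map_mul (boundaryHom d)] at hmem
    rcases le_total 0 t with ht | ht
    · exact mem_closure_of_tendsto (tendsto_conj_boundaryHom hH (tendsto_rescaledIterate hinf hγ
        hexp hM hΦ_hom hΦ_lip hw₀ ht hs hlim).1) (.of_forall fun n => hmem t n)
    -- Only nonnegative iterates were rescaled, so negative times come from the inverses at time
    -- `-t`.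
    · have h := tendsto_conj_boundaryHom hH (tendsto_rescaledIterate hinf hγ
        hexp hM hΦ_hom hΦ_lip hw₀ (neg_nonneg.2 ht) hs hlim).2
      rw [neg_smul, neg_neg] at h
      refine mem_closure_of_tendsto h (.of_forall fun n => ?_)
      rw [← conj_inv]
      exact inv_mem (hmem (-t) n)
  · rw [← map_inv]
    exact isBoundaryMap_boundaryHom H⁻¹
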